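/- **Definitions.** A *$(\lambda,k)$-quasi-geodesic segment* in a metric space $X$ is a map $\gamma\colon[0,\ell]\to X$ with $\lambda^{-1}|t-s|-k\le d(\gamma(t),\gamma(s))\le\lambda|t-s|+k$ for all $t,s\in[0,\ell]$. Let $\lambda\ge1$, $k\ge0$, $E\ge1$, $C\ge0$, let $\theta\colon\mathbb R_{\ge0}\to\mathbb R_{\ge0}$ be non-decreasing, and let $\mathcal L$ be a family of $(\lambda,k)$-quasi-geodesic segments. Then $X$ is *$(\lambda,k,E,C,\theta,\mathcal L)$-coarsely convex* if any two points $v,w\in X$ are the initial and the terminal point of some $\gamma\in\mathcal L$, and if for all $\gamma\colon[0,\ell]\to X$ and $\eta\colon[0,m]\to X$ in $\mathcal L$, all $t\in[0,\ell]$, $s\in[0,m]$ and $0\le c\le1$, $$d(\gamma(ct),\eta(cs))\le cE\,d(\gamma(t),\eta(s))+(1-c)E\,d(\gamma(0),\eta(0))+C,\qquad |t-s|\le\theta\big(d(\gamma(0),\eta(0))+d(\gamma(t),\eta(s))\big).$$ Let $\mathcal L^\infty$ be the set of maps $\gamma\colon\mathbb R_{\ge0}\to X$ with $\gamma(t)=\gamma(\lfloor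 t\rfloor)$ for all $t$ for which there are $\gamma_n\in\mathcal L$ with $\gamma_n(0)=\gamma(0)$, with lengths tending to infinity, and with $\gamma_n(j)\to\gamma(j)$ for every $j\in\mathbb N$. Let $\mathcal L_a^\infty$ be the set of those $\gamma\in\mathcal L^\infty$ with $\gamma(0)=a$. Write $\gamma\sim\eta$ if $\sup_t d(\gamma(t),\eta(t))<\infty$, and put $\partial X=\mathcal L^\infty/{\sim}$ and $\partial_aX=\mathcal L_a^\infty/{\sim}$; for proper $X$ the inclusion induces a bijection $\partial_aX\to\partial X$, by which the two are identified. Let $D=2(1+E)(\lambda+k)+C$. For $\gamma,\eta$ in $\mathcal L\cup\mathcal L^\infty$ starting at $a$ let $(\gamma\mid\eta)_a=\sup\{t\in\operatorname{Dom}\gamma\cap\operatorname{Dom}\eta : d(\gamma(t),\eta(t))\le 2D+2\}$. For $x,y\in X\cup\partial_aX$ let $(x\mid y)_a=0$ if $x$ or $y$ is a point of $X$ at distance at most $2\lambda\theta(0)+k$ from $a$, and otherwise let $(x\mid y)_a\in[0,\infty]$ be the supremum of $(\gamma\mid\eta)_a$ over all $\gamma$ representing $x$ and all $\eta$ representing $y$.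 Here a point $x$ of $X$ is represented by the segments in $\mathcal L$ of length at least $2\theta(0)$ from $a$ to $x$, and an element of $\partial_aX$ by the rays of $\mathcal L_a^\infty$ in it. A fundamental system of neighbourhoods of $z\in X\cup\partial_aX$ is given by the sets $V_n(z)$, $n\ge1$, of those $y$ for which $(z\mid y)_a>n$, or $z,y\in X$ and $d(z,y)<1/n$. **Theorem.** Let $X$ be a proper $(\lambda,k,E,C,\theta,\mathcal L^X)$-coarsely convex space and $Y$ a proper $(\lambda',k',E',C',\theta',\mathcal L^Y)$-coarsely convex space, with base points $a\in X$ and $b\in Y$, and let $f\colon X\to Y$ be a map such that: 1. $f$ is *visual*: there are $A\ge1$, $B\ge0$ with $d(f(x),f(x'))\le A\,d(x,x')+B$ for all $x,x'\in X$, and for all sequences $(x_n),(y_n)$ in $X$ with $(x_n\mid y_n)_a\to\infty$ one has $(f(x_n)\mid f(y_n))_b\to\infty$; 2. $f$ is *$\rho$-$T$-$\mathcal L_a^{X,\infty}$-$\mathcal L_b^{Y,\infty}$-equivariant* for some real $T>0$ and some rough contraction $\rho$, that is, a non-decreasing map $\rho\colon\mathbb R_{\ge0}\to\mathbb R_{\ge0}$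 with $\rho(0)=0$, $\rho(t)\to\infty$ as $t\to\infty$, $\rho(t)\le t$ and $|\rho(t)-\rho(s)|\le|t-s|+\tau$ for all $t,s$, where $\tau\ge0$ is a constant: $f(a)=b$, and for every $\gamma\in\mathcal L_a^{X,\infty}$ there is $\eta\in\mathcal L_b^{Y,\infty}$ with $d(f(\gamma(t)),\eta(\rho(t)))<T$ for all $t\ge0$; 3. $f$ is *coarsely $n$-to-one*, where $n\in\mathbb N$: for every $R>0$ there is $S>0$ such that for every $A\subset Y$ with $\operatorname{diam}A<R$ there are $B_1,\dots,B_n\subset X$ with $\operatorname{diam}B_i<S$ for all $i$ and $f^{-1}(A)=B_1\cup\dots\cup B_n$. Then the induced map $\partial f\colon\partial X\to\partial Y$, that is, the map with $\partial f([\gamma])=\lim_{j\to\infty}f(\gamma(j))$ (limit in $Y\cup\partial_bY$) for all $\gamma\in\mathcal L_a^{X,\infty}$, is well defined (there is exactly one such map), and it is $n$-to-one: each of its point-inverses contains at most $n$ points. -/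

import Mathlib

open Set Filter Topology
open scoped NNReal ENNReal

namespace CoarseConvex

universe u v

/-- A map `[0, len] → X`.  It is stored as a function on `ℝ≥0` of which only the values
on `[0, len]` are ever read. -/
structure Segment (X : Type u) where
  len : ℝ≥0
  toFun : ℝ≥0 → X

/-- `γ` is a `(lam, k)`-quasi-geodesic segment. -/
def Segment.IsQuasiGeodesic {X : Type u} [MetricSpace X] (lam k : ℝ) (γ : Segment X) : Prop :=
  ∀ t s : ℝ≥0, t ≤ γ.len → s ≤ γ.len →
    lam⁻¹ * |(t : ℝ) - s| - k ≤ dist (γ.toFun t) (γ.toFun s) ∧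
      dist (γ.toFun t) (γ.toFun s) ≤ lam * |(t : ℝ) - s| + k

/-- The data and the laws which make `X` a `(lam, k, E, C, θ, L)`-coarsely convex space; `L` is a
system of good quasi-geodesic segments. -/
structure CoarselyConvex (X : Type u) [MetricSpace X] where
  lam : ℝ
  k : ℝ
  E : ℝ
  C : ℝ
  θ : ℝ≥0 → ℝ≥0
  L : Set (Segment X)
  one_le_lam : 1 ≤ lam
  k_nonneg : 0 ≤ k
  one_le_E : 1 ≤ E
  C_nonneg : 0 ≤ C
  θ_mono : Monotone θ
  quasiGeodesic : ∀ γ ∈ L, γ.IsQuasiGeodesic lam k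
  connect : ∀ v w : X, ∃ γ ∈ L, γ.toFun 0 = v ∧ γ.toFun γ.len = w
  convex : ∀ γ ∈ L, ∀ η ∈ L, ∀ t s c : ℝ≥0, t ≤ γ.len → s ≤ η.len → c ≤ 1 →
    dist (γ.toFun (c * t)) (η.toFun (c * s)) ≤
      c * E * dist (γ.toFun t) (η.toFun s) + (1 - c) * E * dist (γ.toFun 0) (η.toFun 0) + C
  param_reg : ∀ γ ∈ L, ∀ η ∈ L, ∀ t s : ℝ≥0, t ≤ γ.len → s ≤ η.len →
    |(t : ℝ) - s| ≤
      θ (nndist (γ.toFun 0) (η.toFun 0) + nndist (γ.toFun t) (η.toFun s))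

namespace CoarselyConvex

variable {X : Type u} [MetricSpace X] (S : CoarselyConvex X)

/-- The constant `k₁ = lam + k`. -/
def k₁ : ℝ := S.lam + S.k

/-- The constant `D = 2 (1 + E) k₁ + C`. -/
def D : ℝ := 2 * (1 + S.E) * S.k₁ + S.C

/-- `γ` is the limit, pointwise on `ℕ`, of good quasi-geodesic segments with the same initial
point as `γ`, whose lengths tend to infinity. -/
def IsApproximatable (γ : ℝ≥0 → X) : Prop :=
  ∃ σ : ℕ → Segment X,
    Tendsto (fun n => (σ n).len) atTop atTop ∧
    (∀ n, σ n ∈ S.L) ∧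
    (∀ n, (σ n).toFun 0 = γ 0) ∧
    ∀ m : ℕ, Tendsto (fun n => (σ n).toFun (m : ℝ≥0)) atTop (𝓝 (γ (m : ℝ≥0)))

/-- The family `L^∞` of rays. -/
def rays : Set (ℝ≥0 → X) :=
  {γ | S.IsApproximatable γ ∧ ∀ t : ℝ≥0, γ t = γ ((⌊t⌋₊ : ℕ) : ℝ≥0)}

/-- The family `L_O^∞` of rays starting at `O`. -/
def raysAt (O : X) : Set (ℝ≥0 → X) :=
  {γ | γ ∈ S.rays ∧ γ 0 = O}

/-- Two maps `ℝ≥0 → X` are equivalent if they stay at bounded distance from each other. -/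
def boundedSetoid (X : Type u) [MetricSpace X] : Setoid (ℝ≥0 → X) where
  r γ η := ∃ M : ℝ, ∀ t, dist (γ t) (η t) ≤ M
  iseqv :=
    { refl := fun γ => ⟨0, fun t => by simp⟩
      symm := fun ⟨M, h⟩ => ⟨M, fun t => by rw [dist_comm]; exact h t⟩
      trans := fun ⟨M, h⟩ ⟨N, h'⟩ =>
        ⟨M + N, fun t => (dist_triangle _ _ _).trans (add_le_add (h t) (h' t))⟩ }

/-- The ideal boundary `∂X = L^∞ / ∼`. -/
def Boundary : Type u :=
  Quotient ((boundedSetoid X).comap (Subtype.val : S.rays → (ℝ≥0 → X)))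

/-- The ideal boundary `∂_O X = L_O^∞ / ∼` with respect to the base point `O`. -/
def BoundaryAt (O : X) : Type u :=
  Quotient ((boundedSetoid X).comap (Subtype.val : S.raysAt O → (ℝ≥0 → X)))

/-- The class in `∂X` of a ray. -/
def cls (γ : S.rays) : S.Boundary := Quotient.mk _ γ

/-- The class in `∂_O X` of a ray starting at `O`. -/
def clsAt {O : X} (γ : S.raysAt O) : S.BoundaryAt O := Quotient.mk _ γ

/-- The map `∂_O X → ∂X` induced by the inclusion of `L_O^∞` into `L^∞`, through which the two
boundaries are identified. -/
def toBoundary {O : X} : S.BoundaryAt O → S.Boundary :=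
  Quotient.map (fun γ : S.raysAt O => (⟨γ.1, γ.2.1⟩ : S.rays)) (fun _ _ h => h)

/-- The product `(γ ∣ η)_O` of two maps with domains `p.1` and `q.1`. -/
noncomputable def pathProd (p q : Set ℝ≥0 × (ℝ≥0 → X)) : ℝ≥0∞ :=
  sSup {r : ℝ≥0∞ | ∃ t : ℝ≥0, t ∈ p.1 ∩ q.1 ∧ dist (p.2 t) (q.2 t) ≤ 2 * S.D + 2 ∧ r = t}

/-- The good quasi-geodesics, with their domains, that start at `O` and represent a given element
of `X ∪ ∂_O X`: segments of length at least `2 θ(0)` ending at a point `x` of `X`, respectively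
rays in a class of `∂_O X`. -/
def reps (O : X) : X ⊕ S.BoundaryAt O → Set (Set ℝ≥0 × (ℝ≥0 → X))
  | Sum.inl x => {p | ∃ γ ∈ S.L, 2 * S.θ 0 ≤ γ.len ∧ γ.toFun 0 = O ∧ γ.toFun γ.len = x ∧
      p = (Iic γ.len, γ.toFun)}
  | Sum.inr ξ => {p | ∃ γ : S.raysAt O, S.clsAt γ = ξ ∧ p = (univ, γ.1)}

/-- The element of `X ∪ ∂_O X` is a point of `X` in the closed ball about `O` of radius
`2 lam θ(0) + k`. -/
def IsNear (O : X) : X ⊕ S.BoundaryAt O → Prop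
  | Sum.inl x => x ∈ Metric.closedBall O (2 * S.lam * S.θ 0 + S.k)
  | Sum.inr _ => False

open Classical in
/-- The product `(x ∣ y)_O` on `X ∪ ∂_O X`. -/
noncomputable def prod (O : X) (x y : X ⊕ S.BoundaryAt O) : ℝ≥0∞ :=
  if S.IsNear O x ∨ S.IsNear O y then 0
  else ⨆ p ∈ S.reps O x, ⨆ q ∈ S.reps O y, S.pathProd p q

/-- The basic entourage `V_n` of `X ∪ ∂_O X`. -/
def entourage (O : X) (n : ℕ) : Set ((X ⊕ S.BoundaryAt O) × (X ⊕ S.BoundaryAt O)) :=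
  {p | (n : ℝ≥0∞) < S.prod O p.1 p.2} ∪
    {p | ∃ x y : X, p = (Sum.inl x, Sum.inl y) ∧ dist x y < (n : ℝ)⁻¹}

/-- Convergence of a sequence in `X ∪ ∂_O X`, for the topology in which the sets `V_n(z)`, `n ≥ 1`,
form a fundamental system of neighbourhoods of `z`. -/
def ConvergesTo (O : X) (x : ℕ → X ⊕ S.BoundaryAt O) (z : X ⊕ S.BoundaryAt O) : Prop :=
  ∀ n : ℕ, 1 ≤ n → ∀ᶠ m in atTop, (z, x m) ∈ S.entourage O n

end CoarselyConvex

/-- Large scale Lipschitz maps. -/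
def IsLargeScaleLipschitz {X : Type u} {Y : Type v} [MetricSpace X] [MetricSpace Y]
    (f : X → Y) : Prop :=
  ∃ A B : ℝ, 1 ≤ A ∧ 0 ≤ B ∧ ∀ x x' : X, dist (f x) (f x') ≤ A * dist x x' + B

/-- Visual maps, for the base points `a` and `b`. -/
def IsVisual {X : Type u} {Y : Type v} [MetricSpace X] [MetricSpace Y]
    (SX : CoarselyConvex X) (SY : CoarselyConvex Y) (a : X) (b : Y) (f : X → Y) : Prop :=
  IsLargeScaleLipschitz f ∧
    ∀ x y : ℕ → X,
      Tendsto (fun n => SX.prod a (Sum.inl (x n)) (Sum.inl (y n))) atTop (𝓝 ⊤) →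
      Tendsto (fun n => SY.prod b (Sum.inl (f (x n))) (Sum.inl (f (y n)))) atTop (𝓝 ⊤)

/-- `g : ∂X → ∂Y` is the map induced by `f`: for every ray `γ` starting at `a`, the sequence
`f (γ n)` converges in `Y ∪ ∂_b Y` to (the point of `∂_b Y` identified with) `g [γ]`. -/
def IsInducedBy {X : Type u} {Y : Type v} [MetricSpace X] [MetricSpace Y]
    (SX : CoarselyConvex X) (SY : CoarselyConvex Y) (a : X) (b : Y) (f : X → Y)
    (g : SX.Boundary → SY.Boundary) : Prop :=
  ∀ γ : SX.raysAt a, ∃ ζ : SY.BoundaryAt b,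
    SY.toBoundary ζ = g (SX.toBoundary (SX.clsAt γ)) ∧
      SY.ConvergesTo b (fun n : ℕ => Sum.inl (f (γ.1 (n : ℝ≥0)))) (Sum.inr ζ)

/-- Rough contractions. -/
def IsRoughContraction (ρ : ℝ≥0 → ℝ≥0) : Prop :=
  ∃ τ : ℝ, 0 ≤ τ ∧ ρ 0 = 0 ∧ Tendsto ρ atTop atTop ∧ (∀ t, ρ t ≤ t) ∧
    (∀ t s : ℝ≥0, |(ρ t : ℝ) - ρ s| ≤ |(t : ℝ) - s| + τ) ∧ Monotone ρ

/-- `ρ`-`T`-`L_a^∞`-`L_b^∞`-equivariant maps. -/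
def IsEquivariant {X : Type u} {Y : Type v} [MetricSpace X] [MetricSpace Y]
    (SX : CoarselyConvex X) (SY : CoarselyConvex Y) (a : X) (b : Y)
    (ρ : ℝ≥0 → ℝ≥0) (T : ℝ) (f : X → Y) : Prop :=
  f a = b ∧ ∀ γ ∈ SX.raysAt a, ∃ η ∈ SY.raysAt b, ∀ t : ℝ≥0, dist (f (γ t)) (η (ρ t)) < T

/-- Coarsely `n`-to-one maps (the diameter of an unbounded set is infinite). -/
def IsCoarselyNToOne {X : Type u} {Y : Type v} [MetricSpace X] [MetricSpace Y]
    (n : ℕ) (f : X → Y) : Prop :=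
  ∀ R : ℝ, 0 < R → ∃ S : ℝ, 0 < S ∧ ∀ A : Set Y, Metric.ediam A < ENNReal.ofReal R →
    ∃ B : Fin n → Set X, (∀ i, Metric.ediam (B i) < ENNReal.ofReal S) ∧ f ⁻¹' A = ⋃ i, B i

/-- Point-inverses contain at most `n` points. -/
def IsNToOne {P : Type u} {Q : Type v} (n : ℕ) (g : P → Q) : Prop :=
  ∀ q : Q, (g ⁻¹' {q}).encard ≤ n

end CoarseConvex

namespace CoarseConvex

universe u v

namespace CoarselyConvex

variable {X : Type u} [MetricSpace X] (S : CoarselyConvex X)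

/-! Suppose n + 1 distinct boundary points of X had the same image, and represent them by rays from
`a`. The rays of Y that shadow their images all lie in one class and start at `b`, so convexity
keeps them within a uniform distance of one another at every time (`dist_le_of_bounded`). All
shadows use the same clock ρ, so at each time u the n + 1 image points form a set of bounded
diameter. Coarse n-to-oneness and the pigeonhole principle then put two of the n + 1 points at time
u within a constant s independent of u. But inequivalent rays are eventually further apart than s
(`bounded_of_frequently`), and there are only finitely many pairs.

The induced map sends a ray to the class of its shadow. This rests on three facts: every boundary
point has a representative from the base point (`toBoundary_surjective`), points near a ray and
moving out along it converge to its class (`convergesTo_of_dist_le`), and such limits are unique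
(`ConvergesTo.unique`). -/

lemma k₁_nonneg : 0 ≤ S.k₁ := by
  have := S.one_le_lam; have := S.k_nonneg; unfold k₁; linarith

lemma four_mul_k₁_le_D : 4 * S.k₁ ≤ S.D := by
  have h := mul_le_mul_of_nonneg_right S.one_le_E S.k₁_nonneg
  have := S.C_nonneg
  unfold D; nlinarith

lemma k_le_k₁ : S.k ≤ S.k₁ := by
  have := S.one_le_lam; unfold k₁; linarith

/-- On every interval `[0, t]` with `t ∈ I`, the map `γ` is uniformly close, up to
`S.k₁` and an arbitrarily small error, to a good segment with the same initial point.
Good segments and rays both have this property. -/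
def IsTraced (I : Set ℝ≥0) (γ : ℝ≥0 → X) : Prop :=
  ∀ t ∈ I, ∀ ε : ℝ, 0 < ε → ∃ σ ∈ S.L, t ≤ σ.len ∧ σ.toFun 0 = γ 0 ∧
    ∀ u ≤ t, dist (σ.toFun u) (γ u) ≤ S.k₁ + ε

variable {S}

/-! ### Metric estimates common to segments and rays -/

lemma isTraced_of_mem {σ : Segment X} (hσ : σ ∈ S.L) : S.IsTraced (Iic σ.len) σ.toFun :=
  fun t ht ε hε => ⟨σ, hσ, ht, rfl, fun u _ => by
    rw [dist_self]; have := S.k₁_nonneg; linarith⟩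

/-- Up to time `t` only finitely many integers matter, so one approximating segment is ε-close at
all of them. Rounding a time down to an integer moves a point of the segment by at most `lam + k =
k₁`. -/
lemma isTraced_of_mem_rays {γ : ℝ≥0 → X} (hγ : γ ∈ S.rays) : S.IsTraced univ γ := by
  obtain ⟨⟨σ, hlen, hL, h0, hlim⟩, hfl⟩ := hγ
  intro t _ ε hε
  have h1 : ∀ᶠ n in atTop, ∀ j ∈ Finset.range (⌊t⌋₊ + 1),
      dist ((σ n).toFun (j : ℝ≥0)) (γ j) < ε := by
    rw [Filter.eventually_all_finset]
    intro j _
    exact (hlim j).eventually (Metric.ball_mem_nhds _ hε)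
  obtain ⟨n, hn, htn⟩ := (h1.and (hlen.eventually_ge_atTop t)).exists
  refine ⟨σ n, hL n, htn, h0 n, fun u hu => ?_⟩
  have hfu : ((⌊u⌋₊ : ℕ) : ℝ≥0) ≤ u := Nat.floor_le zero_le
  have hj := hn ⌊u⌋₊ (Finset.mem_range.2 (Nat.lt_succ_of_le (Nat.floor_mono hu)))
  have hq := (S.quasiGeodesic _ (hL n) u (⌊u⌋₊ : ℝ≥0) (hu.trans htn)
    (hfu.trans (hu.trans htn))).2
  have hlt : (u : ℝ) < ((⌊u⌋₊ : ℝ≥0) : ℝ) + 1 := by exact_mod_cast Nat.lt_floor_add_one u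
  have habs : |(u : ℝ) - ((⌊u⌋₊ : ℝ≥0) : ℝ)| ≤ 1 := by
    rw [abs_le]
    have : ((⌊u⌋₊ : ℝ≥0) : ℝ) ≤ u := by exact_mod_cast hfu
    constructor <;> linarith
  have hmul := mul_le_mul_of_nonneg_left habs (zero_le_one.trans S.one_le_lam)
  have htri := dist_triangle ((σ n).toFun u) ((σ n).toFun (⌊u⌋₊ : ℝ≥0)) (γ u)
  rw [hfl u] at htri ⊢
  unfold k₁
  linarith

lemma IsTraced.dist_le {I : Set ℝ≥0} {γ : ℝ≥0 → X} (h : S.IsTraced I γ) {t s : ℝ≥0}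
    (ht : t ∈ I) (hs : s ∈ I) : dist (γ s) (γ t) ≤ S.lam * |(s : ℝ) - t| + S.D := by
  wlog hst : s ≤ t generalizing s t
  · rw [dist_comm, abs_sub_comm]
    exact this hs ht (le_of_not_ge hst)
  -- With this error the total is `k + 2 * k₁ + lam = 3 * k₁ ≤ D`.
  obtain ⟨σ, hσ, hl, -, hc⟩ := h t ht (S.lam / 2) (by linarith [S.one_le_lam])
  have h1 := hc t le_rfl
  have h2 := hc s hst
  have h3 := (S.quasiGeodesic σ hσ s t (hst.trans hl) hl).2
  have h4 := dist_triangle4 (γ s) (σ.toFun s) (σ.toFun t) (γ t)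
  rw [dist_comm (γ s) (σ.toFun s)] at h4
  have h5 := S.four_mul_k₁_le_D
  have h6 := S.k_nonneg
  have h7 := S.one_le_lam
  unfold k₁ at *
  linarith

lemma IsTraced.le_dist {I : Set ℝ≥0} {γ : ℝ≥0 → X} (h : S.IsTraced I γ) {t : ℝ≥0}
    (ht : t ∈ I) : S.lam⁻¹ * t - (S.D + 2) ≤ dist (γ 0) (γ t) := by
  obtain ⟨σ, hσ, hl, h0, hc⟩ := h t ht 1 one_pos
  have h1 := hc t le_rfl
  have h3 := (S.quasiGeodesic σ hσ t 0 hl zero_le).1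
  have h4 := dist_triangle_right (σ.toFun t) (σ.toFun 0) (γ t)
  rw [NNReal.coe_zero, sub_zero, abs_of_nonneg t.coe_nonneg] at h3
  rw [h0] at h3 h4
  have h5 := S.four_mul_k₁_le_D
  have h6 := S.k₁_nonneg
  have h7 := S.k_le_k₁
  linarith

/-- Replacing both maps by segments costs `2 * k₁` on the left and `2 * E * k₁` on the right. With
`C` this adds up to exactly `D`, once the tracing error tends to 0. -/
lemma IsTraced.dist_mul_le {I J : Set ℝ≥0} {γ η : ℝ≥0 → X} (hγ : S.IsTraced I γ)
    (hη : S.IsTraced J η) {t s c : ℝ≥0} (ht : t ∈ I) (hs : s ∈ J) (hc : c ≤ 1) :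
    dist (γ (c * t)) (η (c * s)) ≤
      c * S.E * dist (γ t) (η s) + (1 - c) * S.E * dist (γ 0) (η 0) + S.D := by
  refine le_of_forall_pos_le_add fun ε hε => ?_
  have hE := S.one_le_E
  set δ := ε / (2 * (1 + S.E)) with hδ
  have hδ0 : 0 < δ := by positivity
  have hδε : 2 * (1 + S.E) * δ = ε := by rw [hδ]; field_simp
  obtain ⟨σ, hσ, hl, h0, hσc⟩ := hγ t ht δ hδ0
  obtain ⟨π, hπ, hm, h0', hπc⟩ := hη s hs δ hδ0
  have h1 := S.convex σ hσ π hπ t s c hl hm hc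
  rw [h0, h0'] at h1
  have h2 := hσc _ (mul_le_of_le_one_left zero_le hc)
  have h3 := hπc _ (mul_le_of_le_one_left zero_le hc)
  have h4 := dist_triangle4 (γ (c * t)) (σ.toFun (c * t)) (π.toFun (c * s)) (η (c * s))
  have h5 := dist_triangle4 (σ.toFun t) (γ t) (η s) (π.toFun s)
  have h6 := hσc t le_rfl
  have h7 := hπc s le_rfl
  rw [dist_comm (γ (c * t)) (σ.toFun _)] at h4
  rw [dist_comm (η s)] at h5
  have h8 : (c : ℝ) * S.E * dist (σ.toFun t) (π.toFun s) ≤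
      c * S.E * dist (γ t) (η s) + S.E * (2 * (S.k₁ + δ)) := by
    have hcE : (0 : ℝ) ≤ c * S.E := mul_nonneg c.coe_nonneg (by linarith)
    have hcE' : (c : ℝ) * S.E ≤ S.E := mul_le_of_le_one_left (by linarith) (by exact_mod_cast hc)
    have hk : 0 ≤ 2 * (S.k₁ + δ) := by have := S.k₁_nonneg; linarith
    have := mul_le_mul_of_nonneg_left (h5.trans
      (show _ ≤ dist (γ t) (η s) + 2 * (S.k₁ + δ) by linarith)) hcE
    have := mul_le_mul_of_nonneg_right hcE' hk
    linarith
  unfold D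
  linarith

/-! ### Fellow travelling -/

variable (S) in
lemma exists_forall_abs_sub_le (M : ℝ) : ∃ K : ℝ, 0 ≤ K ∧
    ∀ ⦃I J : Set ℝ≥0⦄ ⦃γ η : ℝ≥0 → X⦄, S.IsTraced I γ → S.IsTraced J η →
      ∀ ⦃t s : ℝ≥0⦄, t ∈ I → s ∈ J → dist (γ 0) (η 0) + dist (γ t) (η s) ≤ M →
        |(t : ℝ) - s| ≤ K := by
  refine ⟨S.θ (M + 2 * (S.k₁ + 1)).toNNReal, NNReal.coe_nonneg _,
    fun I J γ η hγ hη t s ht hs hM => ?_⟩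
  obtain ⟨σ, hσ, hl, h0, hσc⟩ := hγ t ht 1 one_pos
  obtain ⟨π, hπ, hm, h0', hπc⟩ := hη s hs 1 one_pos
  refine (S.param_reg σ hσ π hπ t s hl hm).trans (NNReal.coe_le_coe.2 (S.θ_mono ?_))
  rw [h0, h0']
  refine NNReal.le_toNNReal_of_coe_le ?_
  rw [NNReal.coe_add, coe_nndist, coe_nndist]
  have h5 := dist_triangle4 (σ.toFun t) (γ t) (η s) (π.toFun s)
  have h6 := hσc t le_rfl
  have h7 := hπc s le_rfl
  rw [dist_comm (η s)] at h5
  linarith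

variable (S) in
-- With `c = u / t`, convexity compares `γ (c * t)` with `η (c * s)`, and the latter is near `η u`
-- because `|c * s - c * t|` is at most `c` times the bound on `|t - s|`. The factor `u / t` is kept
-- so that, for a common origin, the bound at a fixed `u` tends to `2 * D` as `t` grows, below the
-- threshold `2 * D + 2` of the product.
lemma exists_fellow_travel (M : ℝ) : ∃ K : ℝ, 0 ≤ K ∧
    ∀ ⦃I J : Set ℝ≥0⦄ ⦃γ η : ℝ≥0 → X⦄, S.IsTraced I γ → S.IsTraced J η → IsLowerSet J →
      ∀ ⦃t s : ℝ≥0⦄, t ∈ I → s ∈ J → dist (γ 0) (η 0) + dist (γ t) (η s) ≤ M →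
        |(t : ℝ) - s| ≤ K ∧ ∀ u ≤ t, u ∈ J →
          dist (γ u) (η u) ≤ u / t * K + S.E * dist (γ 0) (η 0) + 2 * S.D := by
  obtain ⟨K, hK, h⟩ := S.exists_forall_abs_sub_le M
  have hlam := S.one_le_lam
  have hE := S.one_le_E
  refine ⟨S.E * |M| + S.lam * K + K, by positivity, fun I J γ η hγ hη hJ t s ht hs hM => ?_⟩
  have hts := h hγ hη ht hs hM
  refine ⟨by nlinarith [abs_nonneg M], fun u hut huJ => ?_⟩
  set c : ℝ≥0 := u / t with hc
  have hc1 : c ≤ 1 := div_le_one_of_le₀ hut zero_le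
  have hct : c * t = u := by
    rcases eq_or_ne t 0 with rfl | h0
    · simpa using (le_antisymm hut zero_le).symm
    · exact div_mul_cancel₀ u h0
  have hconv := hγ.dist_mul_le hη ht hs hc1
  rw [hct] at hconv
  have hcR : (c : ℝ) = u / t := by rw [hc, NNReal.coe_div]
  rw [← hcR]
  have hc0 := c.coe_nonneg
  have habs : |((c * s : ℝ≥0) : ℝ) - u| ≤ c * K := by
    rw [← hct, NNReal.coe_mul, NNReal.coe_mul, ← mul_sub, abs_mul, abs_of_nonneg hc0, abs_sub_comm]
    exact mul_le_mul_of_nonneg_left hts hc0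
  have hqg : dist (η (c * s)) (η u) ≤ S.lam * (c * K) + S.D := by
    have hmul := mul_le_mul_of_nonneg_left habs (zero_le_one.trans hlam)
    linarith [hη.dist_le huJ (hJ (mul_le_of_le_one_left zero_le hc1) hs)]
  have htri := dist_triangle (γ u) (η (c * s)) (η u)
  have e1 : (c : ℝ) * S.E * dist (γ t) (η s) ≤ c * (S.E * |M|) := by
    rw [mul_assoc]
    have : dist (γ t) (η s) ≤ |M| := by
      have := le_abs_self M
      have := dist_nonneg (x := γ 0) (y := η 0)
      linarith
    gcongr
  have e2 : (1 - (c : ℝ)) * S.E * dist (γ 0) (η 0) ≤ S.E * dist (γ 0) (η 0) := by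
    have : (0 : ℝ) ≤ c * (S.E * dist (γ 0) (η 0)) := by positivity
    nlinarith
  have e3 : (0 : ℝ) ≤ c * K := by positivity
  nlinarith

variable (S) in
lemma exists_fellow_travel_bound (M : ℝ) : ∃ N : ℝ, 0 ≤ N ∧
    ∀ ⦃I J : Set ℝ≥0⦄ ⦃γ η : ℝ≥0 → X⦄, S.IsTraced I γ → S.IsTraced J η → IsLowerSet J →
      ∀ ⦃t s : ℝ≥0⦄, t ∈ I → s ∈ J → dist (γ 0) (η 0) + dist (γ t) (η s) ≤ M →
        |(t : ℝ) - s| ≤ N ∧ ∀ u ≤ t, u ∈ J → dist (γ u) (η u) ≤ N := by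
  obtain ⟨K, hK, h⟩ := S.exists_fellow_travel M
  have hE := S.one_le_E
  have hD := S.four_mul_k₁_le_D
  have hk := S.k₁_nonneg
  have hEM : 0 ≤ S.E * |M| := by positivity
  refine ⟨K + S.E * |M| + 2 * S.D, by linarith, fun I J γ η hγ hη hJ t s ht hs hM => ?_⟩
  obtain ⟨h1, h2⟩ := h hγ hη hJ ht hs hM
  refine ⟨by linarith, fun u hut huJ => (h2 u hut huJ).trans ?_⟩
  have hc : (u / t : ℝ) ≤ 1 := div_le_one_of_le₀ (by exact_mod_cast hut) t.coe_nonneg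
  have e1 : (u / t : ℝ) * K ≤ K := mul_le_of_le_one_left hK hc
  have e2 : S.E * dist (γ 0) (η 0) ≤ S.E * |M| := by
    have := le_abs_self M
    have := dist_nonneg (x := γ t) (y := η s)
    gcongr
    linarith
  linarith

/-! ### Equivalence of rays and change of base point -/

lemma bounded_of_frequently {γ η : ℝ≥0 → X} (hγ : γ ∈ S.rays) (hη : η ∈ S.rays) {M : ℝ}
    (h : ∀ N : ℝ≥0, ∃ t ≥ N, dist (γ t) (η t) ≤ M) : boundedSetoid X γ η := by
  obtain ⟨B, -, hB⟩ := S.exists_fellow_travel_bound (dist (γ 0) (η 0) + M)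
  refine ⟨B, fun u => ?_⟩
  obtain ⟨t, ht, hd⟩ := h u
  exact (hB (isTraced_of_mem_rays hγ) (isTraced_of_mem_rays hη) isLowerSet_univ
    (mem_univ t) (mem_univ t) (by gcongr)).2 u ht (mem_univ u)

/-- Applying convexity from the much later time `A * u` with factor `A⁻¹` shrinks the unknown bound
`M` to at most 1. -/
lemma dist_le_of_bounded {γ η : ℝ≥0 → X} (hγ : γ ∈ S.rays) (hη : η ∈ S.rays)
    (h0 : γ 0 = η 0) (h : boundedSetoid X γ η) (u : ℝ≥0) : dist (γ u) (η u) ≤ S.D + 1 := by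
  obtain ⟨M, hM⟩ := h
  have hE := S.one_le_E
  have hM0 : 0 ≤ M := dist_nonneg.trans (hM 0)
  obtain ⟨A, hA⟩ : ∃ A : ℝ≥0, (A : ℝ) = S.E * M + 1 :=
    ⟨(S.E * M + 1).toNNReal, Real.coe_toNNReal _ (by positivity)⟩
  have hA0 : A ≠ 0 := by
    rw [← NNReal.coe_ne_zero, hA]
    positivity
  have hA1 : A⁻¹ ≤ 1 := by
    refine inv_le_one_of_one_le₀ ?_
    rw [← NNReal.coe_le_coe, hA, NNReal.coe_one]
    have : 0 ≤ S.E * M := by positivity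
    linarith
  have hc := (isTraced_of_mem_rays hγ).dist_mul_le (isTraced_of_mem_rays hη)
    (mem_univ (A * u)) (mem_univ (A * u)) hA1
  rw [inv_mul_cancel_left₀ hA0, h0, dist_self, mul_zero, add_zero] at hc
  have h1 : ((A⁻¹ : ℝ≥0) : ℝ) * S.E * dist (γ (A * u)) (η (A * u)) ≤ 1 := by
    calc ((A⁻¹ : ℝ≥0) : ℝ) * S.E * dist (γ (A * u)) (η (A * u))
        ≤ ((A⁻¹ : ℝ≥0) : ℝ) * S.E * M := by gcongr; exact hM _
      _ ≤ ((A⁻¹ : ℝ≥0) : ℝ) * A := by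
          rw [mul_assoc]
          gcongr
          rw [hA]
          linarith
      _ = 1 := by rw [← NNReal.coe_mul, inv_mul_cancel₀ hA0, NNReal.coe_one]
  linarith

lemma clsAt_eq_iff {O : X} {γ η : S.raysAt O} :
    S.clsAt γ = S.clsAt η ↔ boundedSetoid X γ.1 η.1 :=
  Quotient.eq (r := (boundedSetoid X).comap (Subtype.val : S.raysAt O → (ℝ≥0 → X)))

lemma toBoundary_injective (O : X) : Function.Injective (S.toBoundary (O := O)) := by
  intro ξ ζ h
  induction ξ using Quotient.inductionOn with | _ γ
  induction ζ using Quotient.inductionOn with | _ η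
  exact Quotient.sound
    ((Quotient.eq (r := (boundedSetoid X).comap (Subtype.val : S.rays → (ℝ≥0 → X)))).1 h)

/-- Every ray is equivalent to a ray from a prescribed initial point. -/
lemma toBoundary_surjective [ProperSpace X] (O : X) :
    Function.Surjective (S.toBoundary (O := O)) := by
  intro ξ
  induction ξ using Quotient.inductionOn with | _ γ
  obtain ⟨γ, hγ⟩ := γ
  -- The new ray is a subsequential limit of segments from `O` to `γ n`, which fellow-travel with
  -- `γ`. Properness and Tychonoff's theorem give convergence at all integers.
  have hγt := isTraced_of_mem_rays hγ
  choose σ hσL hσ0 hσe using fun n : ℕ => S.connect O (γ n)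
  have hσt := fun n => isTraced_of_mem (hσL n)
  obtain ⟨N, -, hN⟩ := S.exists_fellow_travel_bound (dist (γ 0) O)
  have hft := fun n : ℕ => hN hγt (hσt n) (isLowerSet_Iic _) (mem_univ (n : ℝ≥0))
    (le_refl (σ n).len) (by rw [hσ0, hσe, dist_self, add_zero])
  have hlen : Tendsto (fun n => (σ n).len) atTop atTop := by
    rw [← NNReal.tendsto_coe_atTop]
    refine tendsto_atTop_mono (fun n => ?_)
      (tendsto_atTop_add_const_right _ (-N) tendsto_natCast_atTop_atTop)
    have := (abs_le.1 (hft n).1).2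
    rw [NNReal.coe_natCast] at this
    linarith
  -- Truncating at the length avoids meaningless values of the segment; for fixed `j` the truncation
  -- is eventually inactive.
  set p : ℕ → ℕ → X := fun n j => (σ n).toFun (min (j : ℝ≥0) (σ n).len) with hp
  have hpK : ∀ n, p n ∈ Set.pi univ fun j : ℕ => Metric.closedBall O (S.lam * j + S.k) := by
    intro n j _
    rw [Metric.mem_closedBall, ← hσ0 n]
    have hle : ((min (j : ℝ≥0) (σ n).len : ℝ≥0) : ℝ) ≤ j := by
      exact_mod_cast min_le_left (j : ℝ≥0) (σ n).len
    refine (S.quasiGeodesic _ (hσL n) _ 0 (min_le_right _ _) zero_le).2.trans ?_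
    rw [NNReal.coe_zero, sub_zero, abs_of_nonneg (NNReal.coe_nonneg _)]
    have := S.one_le_lam
    gcongr
  obtain ⟨g, -, φ, hφ, hg⟩ :=
    (isCompact_univ_pi fun j : ℕ => isCompact_closedBall O (S.lam * j + S.k)).tendsto_subseq hpK
  rw [tendsto_pi_nhds] at hg
  have hlenφ := hlen.comp hφ.tendsto_atTop
  have hlim : ∀ j : ℕ, Tendsto (fun n => (σ (φ n)).toFun (j : ℝ≥0)) atTop (𝓝 (g j)) := by
    intro j
    refine (hg j).congr' ?_
    filter_upwards [hlenφ.eventually_ge_atTop (j : ℝ≥0)] with n hn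
    simp only [hp, Function.comp_apply] at hn ⊢
    rw [min_eq_left hn]
  have hg0 : g 0 = O := by
    refine tendsto_nhds_unique (hlim 0) ?_
    simp only [Nat.cast_zero, hσ0]
    exact tendsto_const_nhds
  have hray : (fun t : ℝ≥0 => g ⌊t⌋₊) ∈ S.raysAt O := by
    refine ⟨⟨⟨σ ∘ φ, hlenφ, fun n => hσL _, fun n => ?_, fun m => ?_⟩, fun t => ?_⟩, ?_⟩
    · simp only [Function.comp_apply, Nat.floor_zero, hσ0, hg0]
    · simpa only [Function.comp_apply, Nat.floor_natCast] using hlim m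
    · simp only [Nat.floor_natCast]
    · simp only [Nat.floor_zero, hg0]
  refine ⟨S.clsAt ⟨_, hray⟩, Quotient.sound ⟨N, fun t => ?_⟩⟩
  change dist (g ⌊t⌋₊) (γ t) ≤ N
  rw [hγ.2 t]
  refine le_of_tendsto ((hlim _).dist tendsto_const_nhds) ?_
  filter_upwards [hlenφ.eventually_ge_atTop (⌊t⌋₊ : ℝ≥0),
    hφ.tendsto_atTop.eventually_ge_atTop ⌊t⌋₊] with n h1 h2
  rw [dist_comm]
  exact (hft (φ n)).2 _ (by exact_mod_cast h2) h1

/-! ### Convergence to boundary points -/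

lemma exists_of_mem_entourage {O y : X} {ζ : S.BoundaryAt O} {n : ℕ}
    (h : (Sum.inr ζ, Sum.inl y) ∈ S.entourage O n) :
    ∃ γ : S.raysAt O, S.clsAt γ = ζ ∧ ∃ σ ∈ S.L, σ.toFun 0 = O ∧ σ.toFun σ.len = y ∧
      ∃ t : ℝ≥0, (n : ℝ≥0) < t ∧ t ≤ σ.len ∧ dist (γ.1 t) (σ.toFun t) ≤ 2 * S.D + 2 := by
  rcases h with h | ⟨_, _, h, -⟩
  swap
  · simp at h
  simp only [mem_ofPred_eq, prod] at h
  split_ifs at h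
  · simp at h
  simp only [lt_iSup_iff, pathProd, lt_sSup_iff] at h
  obtain ⟨_, ⟨γ, hγ, rfl⟩, _, ⟨σ, hσ, -, h0, he, rfl⟩, _, ⟨t, ht, hd, rfl⟩, hnt⟩ := h
  exact ⟨γ, hγ, σ, hσ, h0, he, t, by exact_mod_cast hnt, ht.2, hd⟩

lemma mem_entourage_of_dist_le {O : X} (γ : S.raysAt O) {σ : Segment X} {n : ℕ} {t : ℝ≥0}
    (hσ : σ ∈ S.L) (h0 : σ.toFun 0 = O) (hlen : 2 * S.θ 0 ≤ σ.len)
    (hfar : 2 * S.lam * S.θ 0 + S.k < dist O (σ.toFun σ.len)) (hnt : (n : ℝ≥0) < t)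
    (ht : t ≤ σ.len) (hd : dist (γ.1 t) (σ.toFun t) ≤ 2 * S.D + 2) :
    (Sum.inr (S.clsAt γ), Sum.inl (σ.toFun σ.len)) ∈ S.entourage O n := by
  left
  have hnear : ¬ (S.IsNear O (Sum.inr (S.clsAt γ)) ∨ S.IsNear O (Sum.inl (σ.toFun σ.len))) := by
    simp only [IsNear, Metric.mem_closedBall, false_or, not_le]
    rwa [dist_comm]
  simp only [mem_ofPred_eq, prod]
  rw [if_neg hnear]
  simp only [lt_iSup_iff, pathProd, lt_sSup_iff]
  exact ⟨_, ⟨γ, rfl, rfl⟩, _, ⟨σ, hσ, hlen, h0, rfl, rfl⟩, _, ⟨t, ⟨mem_univ _, ht⟩, hd, rfl⟩,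
    by exact_mod_cast hnt⟩

lemma ConvergesTo.unique {O : X} {y : ℕ → X} {ζ ζ' : S.BoundaryAt O}
    (h : S.ConvergesTo O (fun m => Sum.inl (y m)) (Sum.inr ζ))
    (h' : S.ConvergesTo O (fun m => Sum.inl (y m)) (Sum.inr ζ')) : ζ = ζ' := by
  obtain ⟨⟨γ₀, hγ₀⟩, rfl⟩ := Quotient.exists_rep ζ
  obtain ⟨⟨γ₀', hγ₀'⟩, rfl⟩ := Quotient.exists_rep ζ'
  obtain ⟨N, -, hN⟩ := S.exists_fellow_travel_bound (2 * S.D + 2)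
  obtain ⟨N₀, -, hN₀⟩ := S.exists_fellow_travel_bound 0
  -- At time `n` the chain is `γ₀`, `γ`, `σ`, `σ'`, `γ'`, `γ₀'`: equivalent rays are `D + 1` apart,
  -- a ray and its segment `N`, and the two segments from `O` to the same `y m` are `N₀` apart.
  refine clsAt_eq_iff.2 (bounded_of_frequently (M := 2 * (S.D + 1) + 2 * N + N₀) hγ₀.1 hγ₀'.1
    fun r => ?_)
  obtain ⟨n, hn⟩ := exists_nat_ge (max r 1)
  have hn1 : 1 ≤ n := by exact_mod_cast (le_max_right r 1).trans hn
  obtain ⟨m, hm, hm'⟩ := ((h n hn1).and (h' n hn1)).exists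
  obtain ⟨γ, hγ, σ, hσ, h0, he, t, hnt, ht, hd⟩ := exists_of_mem_entourage hm
  obtain ⟨γ', hγ', σ', hσ', h0', he', t', hnt', ht', hd'⟩ := exists_of_mem_entourage hm'
  refine ⟨n, (le_max_left _ _).trans hn, ?_⟩
  have e1 := dist_le_of_bounded hγ₀.1 γ.2.1 (hγ₀.2.trans γ.2.2.symm)
    (clsAt_eq_iff.1 hγ.symm) (n : ℝ≥0)
  have e1' := dist_le_of_bounded γ'.2.1 hγ₀'.1 (γ'.2.2.trans hγ₀'.2.symm)
    (clsAt_eq_iff.1 hγ') (n : ℝ≥0)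
  have e2 := (hN (isTraced_of_mem_rays γ.2.1) (isTraced_of_mem hσ) (isLowerSet_Iic _)
    (mem_univ t) ht (by rwa [γ.2.2, h0, dist_self, zero_add])).2 n hnt.le (hnt.le.trans ht)
  have e2' := (hN (isTraced_of_mem_rays γ'.2.1) (isTraced_of_mem hσ') (isLowerSet_Iic _)
    (mem_univ t') ht' (by rwa [γ'.2.2, h0', dist_self, zero_add])).2 n hnt'.le (hnt'.le.trans ht')
  have e3 := (hN₀ (isTraced_of_mem hσ) (isTraced_of_mem hσ') (isLowerSet_Iic _)
    (le_refl σ.len) (le_refl σ'.len) (by rw [h0, h0', he, he', dist_self, dist_self, add_zero])).2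
    n (hnt.le.trans ht) (hnt'.le.trans ht')
  rw [dist_comm] at e2'
  have := dist_triangle4 (γ₀ n) (γ.1 n) (σ.toFun n) (γ₀' n)
  have := dist_triangle4 (σ.toFun n) (σ'.toFun n) (γ'.1 n) (γ₀' n)
  linarith

lemma convergesTo_of_dist_le {O : X} (η : S.raysAt O) {y : ℕ → X} {r : ℕ → ℝ≥0} {T : ℝ}
    (hr : Tendsto r atTop atTop) (h : ∀ m, dist (y m) (η.1 (r m)) ≤ T) :
    S.ConvergesTo O (fun m => Sum.inl (y m)) (Sum.inr (S.clsAt η)) := by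
  intro n _
  have hη := isTraced_of_mem_rays η.2.1
  obtain ⟨K, hK, hft⟩ := S.exists_fellow_travel T
  have hr' : Tendsto (fun m => (r m : ℝ)) atTop atTop := NNReal.tendsto_coe_atTop.2 hr
  have hlam : 0 < S.lam⁻¹ := inv_pos.2 (zero_lt_one.trans_le S.one_le_lam)
  have hfar : Tendsto (fun m => S.lam⁻¹ * (r m : ℝ)) atTop atTop := hr'.const_mul_atTop hlam
  -- In order: time `n + 1` precedes `r m`; it lies in the domain of `σ`; `σ` has length at least `2
  -- * θ 0`; the decaying term is at most 2; `y m` lies outside the excluded ball about `O`.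
  filter_upwards [hr'.eventually_ge_atTop (n + 1), hr'.eventually_ge_atTop (K + (n + 1)),
    hr'.eventually_ge_atTop (K + 2 * S.θ 0), hr'.eventually_ge_atTop ((n + 1) * K / 2),
    hfar.eventually_gt_atTop (2 * S.lam * S.θ 0 + S.k + T + (S.D + 2))] with m h1 h2 h3 h4 h5
  obtain ⟨σ, hσ, h0, he⟩ := S.connect O (y m)
  obtain ⟨hlen, hclose⟩ := hft hη (isTraced_of_mem hσ) (isLowerSet_Iic _) (mem_univ (r m))
    (le_refl σ.len) (by rw [η.2.2, h0, he, dist_self, zero_add, dist_comm]; exact h m)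
  have hlen' := (abs_le.1 hlen).2
  have ht : ((n + 1 : ℝ≥0)) ≤ σ.len := by
    rw [← NNReal.coe_le_coe]; push_cast; linarith
  have hrm : (n + 1 : ℝ≥0) ≤ r m := by
    rw [← NNReal.coe_le_coe]; push_cast; linarith
  rw [← he]
  refine mem_entourage_of_dist_le η (t := n + 1) hσ h0 ?_ ?_ ?_ ht ?_
  · rw [← NNReal.coe_le_coe]; push_cast; linarith
  · have e1 := hη.le_dist (mem_univ (r m))
    have e2 := dist_triangle O (y m) (η.1 (r m))
    rw [η.2.2] at e1
    rw [he]
    linarith [h m]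
  · exact lt_add_one _
  · refine (hclose _ hrm ht).trans ?_
    rw [η.2.2, h0, dist_self, mul_zero, add_zero]
    have hpos : (0 : ℝ) < r m := by
      have : (0 : ℝ) ≤ n := n.cast_nonneg
      linarith
    have : (((n + 1 : ℝ≥0) : ℝ) / r m) * K ≤ 2 := by
      rw [div_mul_eq_mul_div, div_le_iff₀ hpos]
      push_cast
      linarith
    linarith

end CoarselyConvex

/-! ### The induced map and its fibres -/

variable {X : Type u} {Y : Type v} [MetricSpace X] [MetricSpace Y]
  {SX : CoarselyConvex X} {SY : CoarselyConvex Y} {a : X} {b : Y} {f : X → Y}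

open CoarselyConvex

/-- Rays of `Y` which shadow the images of equivalent rays of `X` are equivalent. -/
lemma IsLargeScaleLipschitz.clsAt_eq {ρ : ℝ≥0 → ℝ≥0} {T : ℝ} (hf : IsLargeScaleLipschitz f)
    (hρ : Tendsto ρ atTop atTop) {γ γ' : ℝ≥0 → X} {η η' : SY.raysAt b}
    (hγ : boundedSetoid X γ γ') (h : ∀ t, dist (f (γ t)) (η.1 (ρ t)) < T)
    (h' : ∀ t, dist (f (γ' t)) (η'.1 (ρ t)) < T) : SY.clsAt η = SY.clsAt η' := by
  obtain ⟨A, B, hA, -, hAB⟩ := hf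
  obtain ⟨M, hM⟩ := hγ
  refine clsAt_eq_iff.2 (bounded_of_frequently (M := T + (A * M + B) + T) η.2.1 η'.2.1
    fun N => ?_)
  obtain ⟨t, ht⟩ := (hρ.eventually_ge_atTop N).exists
  refine ⟨ρ t, ht, ?_⟩
  have h1 := h t
  rw [dist_comm] at h1
  have h2 := dist_triangle4 (η.1 (ρ t)) (f (γ t)) (f (γ' t)) (η'.1 (ρ t))
  have h3 := mul_le_mul_of_nonneg_left (hM t) (zero_le_one.trans hA)
  linarith [h' t, hAB (γ t) (γ' t)]

lemma existsUnique_isInducedBy [ProperSpace X] (hf : IsLargeScaleLipschitz f)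
    {ρ : ℝ≥0 → ℝ≥0} {T : ℝ} (hρ : Tendsto ρ atTop atTop)
    (hequiv : IsEquivariant SX SY a b ρ T f) :
    ∃! g : SX.Boundary → SY.Boundary, IsInducedBy SX SY a b f g := by
  have hρn : Tendsto (fun m : ℕ => ρ m) atTop atTop := hρ.comp tendsto_natCast_atTop_atTop
  choose η hηb hη using hequiv.2
  choose γ hγ using fun ξ : SX.Boundary =>
    (show ∃ γ : SX.raysAt a, SX.toBoundary (SX.clsAt γ) = ξ from by
      obtain ⟨ζ, rfl⟩ := toBoundary_surjective a ξ
      obtain ⟨γ, rfl⟩ := Quotient.exists_rep ζ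
      exact ⟨γ, rfl⟩)
  refine ⟨fun ξ => SY.toBoundary (SY.clsAt ⟨_, hηb (γ ξ).1 (γ ξ).2⟩), fun γ₀ => ?_,
    fun g hg => funext fun ξ => ?_⟩
  · refine ⟨_, rfl, ?_⟩
    have hcls := clsAt_eq_iff.1 (toBoundary_injective a (hγ (SX.toBoundary (SX.clsAt γ₀))))
    -- The shadow of the chosen representative may be exchanged for the shadow of `γ₀` itself.
    rw [hf.clsAt_eq (η' := ⟨_, hηb γ₀.1 γ₀.2⟩) hρ hcls (hη _ _) (hη _ _)]
    exact convergesTo_of_dist_le _ hρn fun m => (hη _ γ₀.2 m).le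
  · obtain ⟨ζ, hζ, hlim⟩ := hg (γ ξ)
    rw [hγ] at hζ
    rw [← hζ]
    congr 1
    exact hlim.unique (convergesTo_of_dist_le _ hρn fun m => (hη _ (γ ξ).2 m).le)

lemma IsInducedBy.isNToOne [ProperSpace X] {ρ : ℝ≥0 → ℝ≥0} {T : ℝ} (hT : 0 < T)
    (hρ : Tendsto ρ atTop atTop) (hequiv : IsEquivariant SX SY a b ρ T f) {n : ℕ}
    (hn : IsCoarselyNToOne n f) {g : SX.Boundary → SY.Boundary}
    (hg : IsInducedBy SX SY a b f g) : IsNToOne n g := by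
  intro q
  by_contra! hlt
  obtain ⟨t, htq, htn⟩ := exists_subset_encard_eq (Order.add_one_le_of_lt hlt)
  have htfin : t.Finite := finite_of_encard_eq_coe (k := n + 1) (by exact_mod_cast htn)
  have := htfin.fintype
  have hcard : Fintype.card (Fin n) < Fintype.card t := by
    rw [Fintype.card_fin, ← Nat.card_eq_fintype_card, Nat.card_coe_set_eq, ncard, htn]
    exact Nat.lt_succ_self n
  have hrep : ∀ i : t, ∃ γ : SX.raysAt a, SX.toBoundary (SX.clsAt γ) = i := fun i => by
    obtain ⟨ζ, hζ⟩ := toBoundary_surjective a i.1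
    obtain ⟨γ, rfl⟩ := Quotient.exists_rep ζ
    exact ⟨γ, hζ⟩
  choose γ hγ using hrep
  choose η hηb hη using fun i => hequiv.2 (γ i).1 (γ i).2
  have hρn : Tendsto (fun m : ℕ => ρ m) atTop atTop := hρ.comp tendsto_natCast_atTop_atTop
  have hq : ∀ i, SY.toBoundary (SY.clsAt ⟨η i, hηb i⟩) = q := fun i => by
    obtain ⟨ζ, hζ, hlim⟩ := hg (γ i)
    rw [← hlim.unique (convergesTo_of_dist_le ⟨η i, hηb i⟩ hρn fun m => (hη i m).le), hζ, hγ]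
    exact htq i.2
  have hηd : ∀ i j u, dist (η i u) (η j u) ≤ SY.D + 1 := fun i j =>
    dist_le_of_bounded (hηb i).1 (hηb j).1 ((hηb i).2.trans (hηb j).2.symm)
      (clsAt_eq_iff.1 (toBoundary_injective b ((hq i).trans (hq j).symm)))
  have hD : 0 ≤ SY.D := (mul_nonneg zero_le_four SY.k₁_nonneg).trans SY.four_mul_k₁_le_D
  -- Images at equal times are within `T + (D + 1) + T`; the extra 1 makes the diameter bound
  -- strict. The constant `s` is fixed before the time `u`.
  obtain ⟨s, -, hs⟩ := hn (2 * T + SY.D + 2) (by linarith)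
  have hclose : ∀ u, ∃ i j, i ≠ j ∧ dist ((γ i).1 u) ((γ j).1 u) < s := by
    intro u
    obtain ⟨B, hB, hcover⟩ := hs (range fun i => f ((γ i).1 u)) <| by
      refine (Metric.ediam_le (d := ENNReal.ofReal (2 * T + SY.D + 1)) ?_).trans_lt
        ((ENNReal.ofReal_lt_ofReal_iff (by linarith)).2 (by linarith))
      rintro _ ⟨i, rfl⟩ _ ⟨j, rfl⟩
      rw [edist_dist]
      refine ENNReal.ofReal_le_ofReal ?_
      have h1 := dist_triangle4 (f ((γ i).1 u)) (η i (ρ u)) (η j (ρ u)) (f ((γ j).1 u))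
      have h2 := hη j u
      rw [dist_comm] at h2
      linarith [hη i u, hηd i j (ρ u)]
    have hmem : ∀ i, ∃ κ, (γ i).1 u ∈ B κ := fun i => by
      rw [← mem_iUnion, ← hcover]
      exact ⟨i, rfl⟩
    choose κ hκ using hmem
    obtain ⟨i, j, hij, he⟩ := Fintype.exists_ne_map_eq_of_card_lt κ hcard
    exact ⟨i, j, hij, edist_lt_ofReal.1
      ((Metric.edist_le_ediam_of_mem (hκ i) (he ▸ hκ j)).trans_lt (hB _))⟩
  -- If a pair returned within `s` at arbitrarily late times, its two rays would be equivalent.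
  have hfar : ∀ p : {p : t × t // p.1 ≠ p.2},
      ∀ᶠ u in atTop, s < dist ((γ p.1.1).1 u) ((γ p.1.2).1 u) := by
    rintro ⟨⟨i, j⟩, hij⟩
    by_contra h
    simp only [not_eventually, not_lt, frequently_atTop] at h
    refine hij (Subtype.ext ?_)
    rw [← hγ i, ← hγ j, clsAt_eq_iff.2 (bounded_of_frequently (γ i).2.1 (γ j).2.1 h)]
  obtain ⟨u, hu⟩ := (eventually_all.2 hfar).exists
  obtain ⟨i, j, hij, hlt⟩ := hclose u
  exact (hu ⟨(i, j), hij⟩).not_gt hlt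

end CoarseConvex

theorem theorem5 {X : Type*} {Y : Type*} [MetricSpace X] [MetricSpace Y]
    [ProperSpace X] [ProperSpace Y]
    (SX : CoarseConvex.CoarselyConvex X) (SY : CoarseConvex.CoarselyConvex Y)
    (a : X) (b : Y) (f : X → Y) (hvis : CoarseConvex.IsVisual SX SY a b f)
    (ρ : ℝ≥0 → ℝ≥0) (hρ : CoarseConvex.IsRoughContraction ρ) (T : ℝ) (hT : 0 < T)
    (hequiv : CoarseConvex.IsEquivariant SX SY a b ρ T f)
    (n : ℕ) (hn : CoarseConvex.IsCoarselyNToOne n f) :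
    (∃! g : SX.Boundary → SY.Boundary, CoarseConvex.IsInducedBy SX SY a b f g) ∧
      ∀ g : SX.Boundary → SY.Boundary, CoarseConvex.IsInducedBy SX SY a b f g →
        CoarseConvex.IsNToOne n g := by
  obtain ⟨_, -, -, hlim, -⟩ := hρ
  exact ⟨CoarseConvex.existsUnique_isInducedBy hvis.1 hlim hequiv,
    fun _ hg => hg.isNToOne hT hlim hequiv hn⟩
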